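/- Let $X\in\mathbb R^{n\times p}$ be a fixed design matrix, $B^*\in\mathbb R^{p\times m}$ a fixed matrix, $Y$ a random response matrix in $\mathbb R^{n\times m}$, and $l_0(\,\cdot\,;Y)$ a real-valued loss on $\mathbb R^{n\times m}$ that is differentiable in its first argument. For $B\in\mathbb R^{p\times m}$ let $\|B\|_{2,\mathcal C}$ denote the number of distinct rows of $B$, and put $r^*=\mathrm{rank}(B^*)$, $q^*=\|B^*\|_{2,\mathcal C}$. Write $\mathbf D_2(A_1,A_2)=\|A_1-A_2\|_F^2/2$ and $$\mathbf\Delta_{l_0}(A_1,A_2)=l_0(A_1;Y)-l_0(A_2;Y)-\langle\nabla l_0(A_2;Y),A_1-A_2\rangle .$$ Assume that the effective noise $E=-\nabla l_0(XB^*;Y)$ is sub-Gaussian with mean zero and scale bounded by $\sigma\ge 0$, i.e. $\mathbb E E=0$ and $\|\langle E,A\rangle\|_{\psi_2}\le\sigma\|A\|_F$ for all $A\in\mathbb R^{n\times m}$, where $\|Z\|_{\psi_2}=\inf\{t>0:\mathbb E\exp[(Z/t)^2]\le 2\}$. Let $r\ge r^*$ and $p\ge q\ge q^*$ be integers, and let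 $\hat B$ be an optimal solution of the clustered reduced-rank learning (CRL) problem, that is, a (measurable) global minimizer of $l_0(XB;Y)$ over all $B\in\mathbb R^{p\times m}$ with $\|B\|_{2,\mathcal C}\le q$ and $\mathrm{rank}(B)\le r$. Assume that there is a (nonrandom) $\delta>0$ such that, almost surely, $$\mathbf\Delta_{l_0}(XB_1,XB_2)\ge\delta\,\mathbf D_2(XB_1,XB_2)\qquad\text{for all } B_1,B_2 \text{ with } \|B_i\|_{2,\mathcal C}\le q,\ \mathrm{rank}(B_i)\le r .$$ Then $$\mathbb E\big[\|X\hat B-XB^*\|_F^2\big]\le \frac{C}{\delta^2}\big\{\sigma^2\,(q\wedge\mathrm{rank}(X)+m)\,r+\sigma^2(p-q)\log q+\sigma^2\big\},$$ where $C>0$ is a universal constant (and $0\cdot\log 0=0$ in the trivial case $p=q=0$). -/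

import Mathlib

open MeasureTheory

noncomputable section

namespace CRL

/-- The inner product `⟨A, B⟩` of two matrices, i.e. that of their vectorizations. -/
def frobInner {n m : ℕ} (A B : Matrix (Fin n) (Fin m) ℝ) : ℝ :=
  ∑ i, ∑ j, A i j * B i j

/-- The Frobenius norm. -/
def frobNorm {n m : ℕ} (A : Matrix (Fin n) (Fin m) ℝ) : ℝ :=
  √(∑ i, ∑ j, A i j ^ 2)

/-- `‖B‖_{2,𝒞}`: the number of distinct rows of `B`. -/
def numDistinctRows {p m : ℕ} (B : Matrix (Fin p) (Fin m) ℝ) : ℕ :=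
  (Set.range fun i => B.row i).ncard

/-- The constraint set `{B : ‖B‖_{2,𝒞} ≤ q, rank B ≤ r}`. -/
def constraintSet (p m q r : ℕ) : Set (Matrix (Fin p) (Fin m) ℝ) :=
  {B | numDistinctRows B ≤ q ∧ B.rank ≤ r}

/-- The gradient of a function of a matrix: the matrix of its partial derivatives, i.e. the matrix
which represents the Fréchet derivative with respect to `frobInner`. -/
def grad {n m : ℕ} (ψ : Matrix (Fin n) (Fin m) ℝ → ℝ) (Θ : Matrix (Fin n) (Fin m) ℝ) :
    Matrix (Fin n) (Fin m) ℝ :=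
  Matrix.of fun i j => fderiv ℝ ψ Θ (Matrix.single i j 1)

/-- The generalized Bregman function
`Δ_ψ(α, β) = ψ(α) - ψ(β) - ⟨∇ψ(β), α - β⟩`. -/
def bregman {n m : ℕ} (ψ : Matrix (Fin n) (Fin m) ℝ → ℝ) (α β : Matrix (Fin n) (Fin m) ℝ) : ℝ :=
  ψ α - ψ β - frobInner (grad ψ β) (α - β)

/-- `D₂(A, B) = ‖A - B‖_F² / 2`. -/
def D2 {n m : ℕ} (A B : Matrix (Fin n) (Fin m) ℝ) : ℝ :=
  frobNorm (A - B) ^ 2 / 2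

/-- The effective noise `E = -∇ l₀(X B*; Y)`; the loss `l₀` takes the systematic component first
and the response second. -/
def effectiveNoise {n p m : ℕ}
    (l₀ : Matrix (Fin n) (Fin m) ℝ → Matrix (Fin n) (Fin m) ℝ → ℝ)
    (X : Matrix (Fin n) (Fin p) ℝ) (Bstar : Matrix (Fin p) (Fin m) ℝ)
    (Y : Matrix (Fin n) (Fin m) ℝ) : Matrix (Fin n) (Fin m) ℝ :=
  -grad (fun Θ => l₀ Θ Y) (X * Bstar)

/-- `B` is a globally optimal solution of the CRL problem: it minimizes `l₀(X B; Y)` subject to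
`‖B‖_{2,𝒞} ≤ q` and `rank B ≤ r`. -/
def IsOptimalCRL {n p m : ℕ}
    (l₀ : Matrix (Fin n) (Fin m) ℝ → Matrix (Fin n) (Fin m) ℝ → ℝ)
    (X : Matrix (Fin n) (Fin p) ℝ) (Y : Matrix (Fin n) (Fin m) ℝ) (q r : ℕ)
    (B : Matrix (Fin p) (Fin m) ℝ) : Prop :=
  B ∈ constraintSet p m q r ∧ IsMinOn (fun B' => l₀ (X * B') Y) (constraintSet p m q r) B

/-- The norm `‖Z‖_{ψ₂} = inf {t > 0 : 𝔼 exp((Z / t)²) ≤ 2}`, with the value `∞` if there is no such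
`t`. -/
def psi2Norm {Ω : Type*} [MeasurableSpace Ω] (μ : Measure Ω) (Z : Ω → ℝ) : ENNReal :=
  ⨅ (t : ℝ) (_ : 0 < t) (_ : ∫⁻ ω, ENNReal.ofReal (Real.exp ((Z ω / t) ^ 2)) ∂μ ≤ 2),
    ENNReal.ofReal t

/-- `vec(E)` is a sub-Gaussian random vector with mean zero and scale bounded by `σ`. (The bound on
the marginals makes every entry integrable.) -/
structure IsSubGaussianNoise {Ω : Type*} [MeasurableSpace Ω] {n m : ℕ} (μ : Measure Ω)
    (E : Ω → Matrix (Fin n) (Fin m) ℝ) (σ : ℝ) : Prop where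
  aemeasurable : ∀ i j, AEMeasurable (fun ω => E ω i j) μ
  mean_zero : ∀ i j, ∫ ω, E ω i j ∂μ = 0
  psi2_le : ∀ A : Matrix (Fin n) (Fin m) ℝ,
    psi2Norm μ (fun ω => frobInner (E ω) A) ≤ ENNReal.ofReal (σ * frobNorm A)

end CRL

end

/-! Comparing `Bhat` with `Bstar` by optimality and then using strong convexity gives `δ‖Δ‖²/2 ≤ ⟨E,
Δ⟩` for `Δ = X Bhat - X Bstar`. So it suffices to bound `⟨E, Δ⟩` by `4M‖Δ‖`, with `M` the maximum of
`|⟨E, D⟩|` over a fixed finite net: then `‖Δ‖ ≤ 8M/δ`, and a maximal inequality gives `𝔼 M² ≲ σ²(log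
|net| + 1)`.

The net is counted in two layers. Matrices with at most `q` distinct rows have their column spaces
in one of at most `q ^ (4(p - q))` subspaces (`exists_clustering_subspaces`), which costs `(p - q)
log q`. Once the subspace is fixed, `Δ` has rank at most `2r` and columns in a space of dimension at
most `2 (q ∧ rank X)`. Writing it as a product of two thin factors and netting each
(`exists_lowRank_net`) costs `(q ∧ rank X + m) r`. -/

open MeasureTheory

noncomputable section

namespace CRL

/-! ### Half-nets of unit balls, and linear and bilinear forms on them -/

section Nets

variable {E F : Type*} [NormedAddCommGroup E] [NormedSpace ℝ E] [FiniteDimensional ℝ E]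
  [NormedAddCommGroup F] [NormedSpace ℝ F] [FiniteDimensional ℝ F]

/-- `N` is a `1/2`-net of the closed unit ball, contained in that ball. -/
def IsHalfNet (N : Finset E) : Prop :=
  (∀ c ∈ N, ‖c‖ ≤ 1) ∧ ∀ x : E, ‖x‖ ≤ 1 → ∃ c ∈ N, ‖x - c‖ ≤ 1 / 2

-- A maximal 1-separated subset of the ball of radius 2 is a 1-net of it, and a volume comparison
-- bounds its size by `5 ^ dim`; scaling by 1/2 gives the net.
variable (E) in
theorem exists_isHalfNet :
    ∃ N : Finset E, N.card ≤ 5 ^ Module.finrank ℝ E ∧ IsHalfNet N := by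
  classical
  let P : Finset E → Prop := fun s =>
    (∀ c ∈ s, ‖c‖ ≤ 2) ∧ ∀ c ∈ s, ∀ d ∈ s, c ≠ d → 1 ≤ ‖c - d‖
  let K : Set ℕ := {k | ∃ s, P s ∧ s.card = k}
  have hbdd : BddAbove K := by
    refine ⟨5 ^ Module.finrank ℝ E, ?_⟩
    rintro k ⟨s, hs, rfl⟩
    exact Besicovitch.card_le_of_separated s hs.1 hs.2
  have hne : K.Nonempty := ⟨0, ∅, by simp [P], rfl⟩
  obtain ⟨s, hs, hcard⟩ := Nat.sSup_mem hne hbdd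
  have hcover : ∀ x : E, ‖x‖ ≤ 2 → ∃ c ∈ s, ‖x - c‖ ≤ 1 := by
    intro x hx
    by_contra! hfar
    have hxs : x ∉ s := fun h => by
      have := hfar x h
      norm_num at this
    have hins : P (insert x s) := by
      refine ⟨?_, ?_⟩
      · intro c hc
        rcases Finset.mem_insert.1 hc with rfl | hc
        · exact hx
        · exact hs.1 c hc
      · intro c hc d hd hcd
        rcases Finset.mem_insert.1 hc with rfl | hc' <;>
          rcases Finset.mem_insert.1 hd with rfl | hd'
        · exact absurd rfl hcd
        · exact (hfar d hd').le
        · rw [norm_sub_rev]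
          exact (hfar c hc').le
        · exact hs.2 c hc' d hd' hcd
    have hle : (insert x s).card ≤ sSup K := le_csSup hbdd ⟨_, hins, rfl⟩
    rw [Finset.card_insert_of_notMem hxs, hcard] at hle
    omega
  refine ⟨s.image fun x => (2⁻¹ : ℝ) • x,
    Finset.card_image_le.trans (Besicovitch.card_le_of_separated s hs.1 hs.2), ?_, ?_⟩
  · intro c hc
    obtain ⟨d, hd, rfl⟩ := Finset.mem_image.1 hc
    have := hs.1 d hd
    rw [norm_smul]
    norm_num
    linarith
  · intro x hx
    obtain ⟨c, hc, hxc⟩ := hcover ((2 : ℝ) • x) (by rw [norm_smul]; norm_num; linarith)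
    refine ⟨_, Finset.mem_image_of_mem _ hc, ?_⟩
    have : x - (2⁻¹ : ℝ) • c = (2⁻¹ : ℝ) • ((2 : ℝ) • x - c) := by
      rw [smul_sub, smul_smul]
      norm_num
    rw [this, norm_smul]
    norm_num
    linarith

theorem IsHalfNet.abs_le_of_linear {N : Finset E} (hN : IsHalfNet N) (f : E →ₗ[ℝ] ℝ) {M : ℝ}
    (hM : ∀ c ∈ N, |f c| ≤ M) (x : E) : |f x| ≤ 2 * M * ‖x‖ := by
  let g : E →L[ℝ] ℝ := LinearMap.toContinuousLinearMap f
  have hM0 : 0 ≤ M := by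
    obtain ⟨c, hc, -⟩ := hN.2 0 (by simp)
    exact (abs_nonneg _).trans (hM c hc)
  -- Self-bounding: the error of replacing a unit vector by a net point is at most half the norm
  -- being estimated.
  have hg : ‖g‖ ≤ M + ‖g‖ / 2 := by
    refine ContinuousLinearMap.opNorm_le_of_unit_norm (by positivity) fun y hy => ?_
    obtain ⟨c, hc, hyc⟩ := hN.2 y hy.le
    calc ‖g y‖ = ‖g c + g (y - c)‖ := by simp
      _ ≤ ‖g c‖ + ‖g (y - c)‖ := norm_add_le _ _
      _ ≤ M + ‖g‖ * (1 / 2) :=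
        add_le_add (hM c hc) ((g.le_opNorm _).trans (by gcongr))
      _ = M + ‖g‖ / 2 := by ring
  exact (g.le_opNorm x).trans (by gcongr; linarith)

theorem IsHalfNet.abs_le_of_bilinear {N₁ : Finset E} {N₂ : Finset F} (h₁ : IsHalfNet N₁)
    (h₂ : IsHalfNet N₂) (b : E →ₗ[ℝ] F →ₗ[ℝ] ℝ) {M : ℝ}
    (hM : ∀ x ∈ N₁, ∀ y ∈ N₂, |b x y| ≤ M) (x : E) (y : F) : |b x y| ≤ 4 * M * ‖x‖ * ‖y‖ := by
  have := h₁.abs_le_of_linear (b.flip y)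
    (fun c hc => h₂.abs_le_of_linear (b c) (fun d hd => hM c hc d hd) y) x
  exact this.trans_eq (by ring)

end Nets

/-! ### Nets for low-rank matrices through thin factorizations -/

section Factorization

/-- A subspace of dimension at most `k` has a Parseval frame with `k` elements whose synthesis
operator is a contraction. -/
theorem exists_frame {E : Type*} [NormedAddCommGroup E] [InnerProductSpace ℝ E]
    (S : Submodule ℝ E) [FiniteDimensional ℝ S] {k : ℕ} (hk : Module.finrank ℝ S ≤ k) :
    ∃ v : Fin k → E, (∀ x : Fin k → ℝ, ‖∑ l, x l • v l‖ ^ 2 ≤ ∑ l, x l ^ 2) ∧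
      ∀ y ∈ S, ∑ l, inner ℝ (v l) y • v l = y ∧ ∑ l, inner ℝ (v l) y ^ 2 = ‖y‖ ^ 2 := by
  obtain ⟨c, rfl⟩ := Nat.exists_eq_add_of_le hk
  let b := stdOrthonormalBasis ℝ S
  -- An orthonormal basis of `S`, padded with zeros to exactly `k` vectors.
  refine ⟨Fin.append (fun l => (b l : E)) 0, fun x => ?_, fun y hy => ⟨?_, ?_⟩⟩
  · simp only [Fin.sum_univ_add, Fin.append_left, Fin.append_right, Pi.zero_apply, smul_zero,
      Finset.sum_const_zero, add_zero]
    have h : ∑ l, x (Fin.castAdd c l) • (b l : E) =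
        ((∑ l, x (Fin.castAdd c l) • b l : S) : E) := by
      simp
    have h' : ‖∑ l, x (Fin.castAdd c l) • b l‖ ^ 2 = ∑ l, x (Fin.castAdd c l) ^ 2 := by
      have := b.orthonormal.inner_sum (fun l => x (Fin.castAdd c l))
        (fun l => x (Fin.castAdd c l)) Finset.univ
      rw [real_inner_self_eq_norm_sq] at this
      rw [this]
      exact Finset.sum_congr rfl fun l _ => by simp [sq]
    rw [h, Submodule.norm_coe, h']
    exact le_add_of_nonneg_right (Finset.sum_nonneg fun _ _ => sq_nonneg _)
  · have := congrArg (Subtype.val) (b.sum_repr' ⟨y, hy⟩)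
    simpa [Fin.sum_univ_add] using this
  · have := b.sum_sq_norm_inner_right ⟨y, hy⟩
    simpa [Fin.sum_univ_add] using this

variable {n m k : ℕ}

theorem frobNorm_sq (A : Matrix (Fin n) (Fin m) ℝ) : frobNorm A ^ 2 = ∑ i, ∑ j, A i j ^ 2 :=
  Real.sq_sqrt (by positivity)

theorem frobNorm_nonneg (A : Matrix (Fin n) (Fin m) ℝ) : 0 ≤ frobNorm A :=
  Real.sqrt_nonneg _

/-- The subspace `V`, with the Euclidean norm. -/
abbrev euclideanSubmodule (V : Submodule ℝ (Fin n → ℝ)) :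
    Submodule ℝ (EuclideanSpace ℝ (Fin n)) :=
  V.comap (WithLp.linearEquiv 2 ℝ (Fin n → ℝ)).toLinearMap

/-- `k`-tuples of vectors in `V`, with the `ℓ²`-norm. -/
abbrev LeftFactor (V : Submodule ℝ (Fin n → ℝ)) (k : ℕ) : Type :=
  PiLp 2 fun _ : Fin k => euclideanSubmodule V

/-- `m × k` matrices with the spectral norm. -/
abbrev RightFactor (k m : ℕ) : Type :=
  EuclideanSpace ℝ (Fin k) →L[ℝ] EuclideanSpace ℝ (Fin m)

variable {V : Submodule ℝ (Fin n → ℝ)}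

instance : NormedSpace ℝ (LeftFactor V k) :=
  PiLp.normedSpace 2 ℝ fun _ : Fin k => euclideanSubmodule V

/-- The `i`-th row of the left factor. -/
def leftRow (L : LeftFactor V k) (i : Fin n) : EuclideanSpace ℝ (Fin k) :=
  WithLp.toLp 2 fun l => (L l : EuclideanSpace ℝ (Fin n)) i

theorem leftRow_add (L L' : LeftFactor V k) (i : Fin n) :
    leftRow (L + L') i = leftRow L i + leftRow L' i :=
  rfl

theorem leftRow_smul (c : ℝ) (L : LeftFactor V k) (i : Fin n) :
    leftRow (c • L) i = c • leftRow L i :=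
  rfl

theorem norm_sq_leftFactor (L : LeftFactor V k) :
    ‖L‖ ^ 2 = ∑ l, ∑ i, (L l : EuclideanSpace ℝ (Fin n)) i ^ 2 := by
  rw [PiLp.norm_sq_eq_of_L2]
  exact Finset.sum_congr rfl fun l _ => EuclideanSpace.real_norm_sq_eq _

/-- The matrix product of the two factors. -/
def factorProd (L : LeftFactor V k) (R : RightFactor k m) : Matrix (Fin n) (Fin m) ℝ :=
  Matrix.of fun i j => R (leftRow L i) j

theorem frobNorm_factorProd_le (L : LeftFactor V k) (R : RightFactor k m) :
    frobNorm (factorProd L R) ≤ ‖R‖ * ‖L‖ := by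
  refine Real.sqrt_le_iff.2 ⟨by positivity, ?_⟩
  have hL : ‖L‖ ^ 2 = ∑ i, ‖leftRow L i‖ ^ 2 := by
    simp only [norm_sq_leftFactor, EuclideanSpace.real_norm_sq_eq]
    exact Finset.sum_comm
  rw [mul_pow, hL, Finset.mul_sum]
  refine Finset.sum_le_sum fun i _ => ?_
  rw [← mul_pow]
  calc ∑ j, factorProd L R i j ^ 2 = ‖R (leftRow L i)‖ ^ 2 :=
        (EuclideanSpace.real_norm_sq_eq _).symm
    _ ≤ _ := by gcongr; exact R.le_opNorm _

/-- The bilinear form `(L, R) ↦ ⟨A, L R⟩`. -/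
def factorForm (V : Submodule ℝ (Fin n → ℝ)) (k : ℕ) (A : Matrix (Fin n) (Fin m) ℝ) :
    LeftFactor V k →ₗ[ℝ] RightFactor k m →ₗ[ℝ] ℝ :=
  LinearMap.mk₂ ℝ (fun L R => frobInner A (factorProd L R))
    (fun L L' R => by
      simp [frobInner, factorProd, leftRow_add, mul_add, Finset.sum_add_distrib])
    (fun c L R => by
      simp [frobInner, factorProd, leftRow_smul, Finset.mul_sum, mul_left_comm])
    (fun L R R' => by
      simp [frobInner, factorProd, mul_add, Finset.sum_add_distrib])
    (fun c L R => by
      simp [frobInner, factorProd, Finset.mul_sum, mul_left_comm])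

/-- Expand the rows of `Δ` in a frame `v` of the row space: the coefficients `Δ v_l` form `L`, and
synthesis from the frame is `R`. All of the Frobenius norm sits in `L`, while `R` is a contraction.
-/
theorem exists_factorization (Δ : Matrix (Fin n) (Fin m) ℝ) (hV : ∀ x, Δ.mulVec x ∈ V)
    (hk : Δ.rank ≤ k) :
    ∃ (L : LeftFactor V k) (R : RightFactor k m), ‖L‖ = frobNorm Δ ∧ ‖R‖ ≤ 1 ∧
      factorProd L R = Δ := by
  let row : Fin n → EuclideanSpace ℝ (Fin m) := fun i => WithLp.toLp 2 (Δ i)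
  let S := Submodule.span ℝ (Set.range row)
  have hS : Module.finrank ℝ S ≤ k := by
    have h : S = (Submodule.span ℝ (Set.range Δ.row)).map
        (WithLp.linearEquiv 2 ℝ (Fin m → ℝ)).symm.toLinearMap := by
      rw [Submodule.map_span, ← Set.range_comp]
      rfl
    rw [h]
    refine (Submodule.finrank_map_le _ _).trans ?_
    rwa [← Matrix.rank_eq_finrank_span_row]
  obtain ⟨v, hv, hvS⟩ := exists_frame S hS
  have hrow : ∀ i, row i ∈ S := fun i => Submodule.subset_span ⟨i, rfl⟩
  have hinner : ∀ l i, inner ℝ (v l) (row i) = Δ.mulVec (v l).ofLp i := fun l i => by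
    simp [row, PiLp.inner_apply, Matrix.mulVec, dotProduct]
  let L : LeftFactor V k := WithLp.toLp 2 fun l =>
    ⟨WithLp.toLp 2 (Δ.mulVec (v l).ofLp), hV _⟩
  let R₀ : EuclideanSpace ℝ (Fin k) →ₗ[ℝ] EuclideanSpace ℝ (Fin m) :=
    { toFun := fun x => ∑ l, x l • v l
      map_add' := fun x y => by simp [add_smul, Finset.sum_add_distrib]
      map_smul' := fun c x => by simp [mul_smul, Finset.smul_sum] }
  refine ⟨L, LinearMap.toContinuousLinearMap R₀, ?_, ?_, ?_⟩
  · rw [← sq_eq_sq₀ (norm_nonneg _) (frobNorm_nonneg _), frobNorm_sq, norm_sq_leftFactor]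
    have h1 : ∀ i, ∑ j, Δ i j ^ 2 = ∑ l, Δ.mulVec (v l).ofLp i ^ 2 := fun i => by
      have := (hvS _ (hrow i)).2
      rw [EuclideanSpace.real_norm_sq_eq] at this
      rw [← this]
      simp only [hinner]
    simp only [h1]
    exact Finset.sum_comm
  · refine ContinuousLinearMap.opNorm_le_bound _ zero_le_one fun x => ?_
    rw [one_mul]
    refine (sq_le_sq₀ (norm_nonneg _) (norm_nonneg _)).1 ?_
    rw [EuclideanSpace.real_norm_sq_eq x]
    exact hv _
  · ext i j
    have := congrArg (fun y : EuclideanSpace ℝ (Fin m) => y j) (hvS _ (hrow i)).1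
    simp only [hinner] at this
    exact this

theorem finrank_leftFactor (V : Submodule ℝ (Fin n → ℝ)) (k : ℕ) :
    Module.finrank ℝ (LeftFactor V k) = k * Module.finrank ℝ V := by
  have h : Module.finrank ℝ (euclideanSubmodule V) = Module.finrank ℝ V := by
    refine LinearEquiv.finrank_eq ?_
    exact (WithLp.linearEquiv 2 ℝ (Fin n → ℝ)).ofSubmodule' V
  rw [LinearEquiv.finrank_eq (WithLp.linearEquiv 2 ℝ (Fin k → euclideanSubmodule V)),
    Module.finrank_pi_fintype]
  simp [h]

theorem finrank_rightFactor (k m : ℕ) : Module.finrank ℝ (RightFactor k m) = k * m := by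
  rw [← LinearEquiv.finrank_eq (LinearMap.toContinuousLinearMap :
    (EuclideanSpace ℝ (Fin k) →ₗ[ℝ] EuclideanSpace ℝ (Fin m)) ≃ₗ[ℝ] RightFactor k m),
    Module.finrank_linearMap]
  simp

/-- A finite set of matrices in the Frobenius unit ball which controls `⟨A, Δ⟩` for all matrices
`Δ` of rank at most `k` with column space in `V`. -/
theorem exists_lowRank_net (V : Submodule ℝ (Fin n → ℝ)) (k m : ℕ) :
    ∃ N : Finset (Matrix (Fin n) (Fin m) ℝ), N.Nonempty ∧
      N.card ≤ 5 ^ (k * (Module.finrank ℝ V + m)) ∧ (∀ D ∈ N, frobNorm D ≤ 1) ∧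
      ∀ (A Δ : Matrix (Fin n) (Fin m) ℝ) (M : ℝ), (∀ x, Δ.mulVec x ∈ V) → Δ.rank ≤ k →
        (∀ D ∈ N, |frobInner A D| ≤ M) → frobInner A Δ ≤ 4 * M * frobNorm Δ := by
  classical
  obtain ⟨N₁, hc₁, h₁⟩ := exists_isHalfNet (LeftFactor V k)
  obtain ⟨N₂, hc₂, h₂⟩ := exists_isHalfNet (RightFactor k m)
  refine ⟨Finset.image₂ factorProd N₁ N₂, ?_, ?_, ?_, ?_⟩
  · obtain ⟨c, hc, -⟩ := h₁.2 0 (by simp)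
    obtain ⟨d, hd, -⟩ := h₂.2 0 (by simp)
    exact ⟨_, Finset.mem_image₂_of_mem hc hd⟩
  · rw [finrank_leftFactor] at hc₁
    rw [finrank_rightFactor] at hc₂
    refine (Finset.card_image₂_le _ _ _).trans ?_
    rw [mul_add, pow_add]
    exact Nat.mul_le_mul hc₁ hc₂
  · intro D hD
    obtain ⟨L, hL, R, hR, rfl⟩ := Finset.mem_image₂.1 hD
    exact (frobNorm_factorProd_le L R).trans
      (mul_le_one₀ (h₂.1 R hR) (norm_nonneg _) (h₁.1 L hL))
  · intro A Δ M hV hk hM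
    obtain ⟨L, R, hL, hR, rfl⟩ := exists_factorization Δ hV hk
    have hb := h₁.abs_le_of_bilinear h₂ (factorForm V k A)
      (fun x hx y hy => hM _ (Finset.mem_image₂_of_mem hx hy)) L R
    have hM0 : 0 ≤ M := by
      obtain ⟨c, hc, -⟩ := h₁.2 0 (by simp)
      obtain ⟨d, hd, -⟩ := h₂.2 0 (by simp)
      exact (abs_nonneg _).trans (hM _ (Finset.mem_image₂_of_mem hc hd))
    calc frobInner A (factorProd L R) ≤ 4 * M * ‖L‖ * ‖R‖ := (le_abs_self _).trans hb
      _ ≤ 4 * M * ‖L‖ * 1 := by gcongr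
      _ = _ := by rw [mul_one, hL]

end Factorization

/-! ### Counting the column spaces of row-clustered matrices -/

section Clusterings

theorem exists_representatives {p m q : ℕ} (hqp : q ≤ p) (B : Matrix (Fin p) (Fin m) ℝ)
    (hB : numDistinctRows B ≤ q) :
    ∃ (T : Finset (Fin p)) (rep : Fin p → Fin p), T.card = q ∧
      ∀ i, rep i ∈ T ∧ B (rep i) = B i := by
  classical
  let g : Set.range B.row → Fin p := Set.rangeSplitting B.row
  have hcard : (Finset.univ.image g).card ≤ q := by
    refine Finset.card_image_le.trans ?_
    rw [Finset.card_univ, ← Nat.card_eq_fintype_card]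
    exact hB
  obtain ⟨T, hT, hTq⟩ := Finset.exists_superset_card_eq hcard (by simpa using hqp)
  refine ⟨T, fun i => g ⟨B.row i, i, rfl⟩, hTq, fun i => ⟨hT (by simp), ?_⟩⟩
  exact Set.apply_rangeSplitting B.row ⟨B.row i, i, rfl⟩

/-- A family of at most `q ^ (4 * (p - q))` subspaces of dimension at most `q` such that each matrix
with at most `q` distinct rows has its column space in one of them. -/
theorem exists_clustering_subspaces {p q : ℕ} (hqp : q ≤ p) (m : ℕ) :
    ∃ 𝒲 : Finset (Submodule ℝ (Fin p → ℝ)), 𝒲.card ≤ q ^ (4 * (p - q)) ∧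
      (∀ W ∈ 𝒲, Module.finrank ℝ W ≤ q) ∧
      ∀ B : Matrix (Fin p) (Fin m) ℝ, numDistinctRows B ≤ q →
        ∃ W ∈ 𝒲, ∀ x, B.mulVec x ∈ W := by
  classical
  rcases le_or_gt (2 * q) p with h | h
  -- Few clusters: list all `q ^ p` assignments, since `p ≤ 2(p - q)` here.
  · refine ⟨Finset.univ.image fun f : Fin p → Fin q => LinearMap.range (LinearMap.funLeft ℝ ℝ f),
      ?_, ?_, ?_⟩
    · refine Finset.card_image_le.trans ?_
      rw [Finset.card_univ, Fintype.card_fun, Fintype.card_fin, Fintype.card_fin]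
      rcases Nat.eq_zero_or_pos q with rfl | hq
      · rcases Nat.eq_zero_or_pos p with rfl | hp
        · simp
        · simp [hp.ne']
      · exact Nat.pow_le_pow_right hq (by omega)
    · intro W hW
      obtain ⟨f, -, rfl⟩ := Finset.mem_image.1 hW
      exact (LinearMap.finrank_range_le _).trans_eq (by simp)
    · intro B hB
      obtain ⟨T, rep, hT, hrep⟩ := exists_representatives hqp B hB
      let e := T.equivFinOfCardEq hT
      refine ⟨_, Finset.mem_image_of_mem _ (Finset.mem_univ fun i => e ⟨rep i, (hrep i).1⟩),
        fun x => ⟨fun j => B.mulVec x (e.symm j), ?_⟩⟩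
      ext i
      simp [LinearMap.funLeft_apply, Matrix.mulVec, (hrep i).2]
  -- Many clusters: `q ^ p` is too large. Instead impose `p - q` equalities of coordinates, one
  -- tying each non-representative to its representative; there are `p ^ (2(p - q))` choices.
  · let W : (Fin (p - q) → Fin p × Fin p) → Submodule ℝ (Fin p → ℝ) := fun c =>
      ⨅ l, LinearMap.ker (LinearMap.proj (R := ℝ) (φ := fun _ : Fin p => ℝ) (c l).1 -
        LinearMap.proj (c l).2)
    have hmem : ∀ c v, v ∈ W c ↔ ∀ l, v (c l).1 = v (c l).2 := fun c v => by
      simp [W, sub_eq_zero]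
    -- Redundant equalities cut out spaces of dimension above `q`; these are discarded.
    refine ⟨(Finset.univ.image W).filter fun U => Module.finrank ℝ U ≤ q, ?_,
      fun U hU => (Finset.mem_filter.1 hU).2, ?_⟩
    · refine (Finset.card_filter_le _ _).trans (Finset.card_image_le.trans ?_)
      rw [Finset.card_univ, Fintype.card_fun, Fintype.card_prod, Fintype.card_fin, Fintype.card_fin,
        show 4 * (p - q) = 2 * 2 * (p - q) by ring, mul_assoc, pow_mul, pow_mul, ← pow_two,
        ← pow_mul, ← pow_mul, mul_comm 2 (p - q), pow_mul', pow_mul' (q ^ 2)]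
      have hpq : p ≤ q ^ 2 := by
        rcases Nat.lt_or_ge 1 q with hq | hq
        · nlinarith
        · interval_cases q <;> omega
      gcongr
    · intro B hB
      obtain ⟨T, rep, hT, hrep⟩ := exists_representatives hqp B hB
      let e : (Tᶜ : Finset (Fin p)) ≃ Fin (p - q) :=
        Finset.equivFinOfCardEq (by rw [Finset.card_compl, hT, Fintype.card_fin])
      let c : Fin (p - q) → Fin p × Fin p := fun l => (e.symm l, rep (e.symm l))
      refine ⟨W c, Finset.mem_filter.2 ⟨Finset.mem_image_of_mem _ (Finset.mem_univ _), ?_⟩,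
        fun x => (hmem c _).2 fun l => ?_⟩
      · let φ : W c →ₗ[ℝ] (T → ℝ) :=
          (LinearMap.funLeft ℝ ℝ ((↑) : T → Fin p)).comp (W c).subtype
        have hφ : Function.Injective φ := by
          refine (injective_iff_map_eq_zero φ).2 fun v hv => ?_
          have hv0 : ∀ i ∈ T, (v : Fin p → ℝ) i = 0 := fun i hi => congrFun hv ⟨i, hi⟩
          ext i
          by_cases hi : i ∈ T
          · exact hv0 i hi
          · have := (hmem c _).1 v.2 (e ⟨i, Finset.mem_compl.2 hi⟩)
            simp only [c, Equiv.symm_apply_apply] at this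
            rw [this]
            exact hv0 _ (hrep i).1
        exact (LinearMap.finrank_le_finrank_of_injective hφ).trans_eq (by simp [hT])
      · simp [c, Matrix.mulVec, (hrep _).2]

end Clusterings

/-! ### Maximal inequality from the `ψ₂` norm -/

section Expectation

variable {Ω : Type*} [MeasurableSpace Ω] {μ : Measure Ω}

theorem lintegral_exp_sq_le_two {Z : Ω → ℝ} {s t : ℝ} (hZ : psi2Norm μ Z ≤ ENNReal.ofReal s)
    (hst : s < t) (ht : 0 < t) :
    ∫⁻ ω, ENNReal.ofReal (Real.exp ((Z ω / t) ^ 2)) ∂μ ≤ 2 := by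
  have hlt : psi2Norm μ Z < ENNReal.ofReal t :=
    hZ.trans_lt ((ENNReal.ofReal_lt_ofReal_iff ht).2 hst)
  simp only [psi2Norm, iInf_lt_iff] at hlt
  obtain ⟨u, hu, hle, hut⟩ := hlt
  have hut : u < t := (ENNReal.ofReal_lt_ofReal_iff ht).1 hut
  refine (lintegral_mono fun ω => ENNReal.ofReal_le_ofReal (Real.exp_le_exp.2 ?_)).trans hle
  rw [div_pow, div_pow]
  gcongr

/-- A maximal inequality: the expected squared maximum of finitely many sub-Gaussian variables. -/
theorem integral_le_of_le_sq_max [IsProbabilityMeasure μ] {ι : Type*} {N : Finset ι}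
    (hN : N.Nonempty) {Z : ι → Ω → ℝ} {t c K : ℝ} (ht : 0 < t) (hc : 0 ≤ c)
    (hK : (N.card : ℝ) ≤ K) (hZm : ∀ i ∈ N, AEMeasurable (Z i) μ)
    (hZ : ∀ i ∈ N, ∫⁻ ω, ENNReal.ofReal (Real.exp ((Z i ω / t) ^ 2)) ∂μ ≤ 2)
    {f : Ω → ℝ} (hfm : AEStronglyMeasurable f μ) (hf0 : ∀ ω, 0 ≤ f ω)
    (hf : ∀ᵐ ω ∂μ, ∀ M, (∀ i ∈ N, |Z i ω| ≤ M) → f ω ≤ c * M ^ 2) :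
    Integrable f μ ∧ ∫ ω, f ω ∂μ ≤ c * t ^ 2 * (Real.log K + 1) := by
  have hK0 : 0 < K := lt_of_lt_of_le (by exact_mod_cast hN.card_pos) hK
  let g : ι → Ω → ℝ := fun i ω => Real.exp ((Z i ω / t) ^ 2)
  have hgm : ∀ i ∈ N, AEMeasurable (g i) μ := fun i hi =>
    Real.measurable_exp.comp_aemeasurable (((hZm i hi).div_const t).pow_const 2)
  have hgi : ∀ i ∈ N, Integrable (g i) μ := fun i hi => by
    refine ⟨(hgm i hi).aestronglyMeasurable, ?_⟩
    rw [hasFiniteIntegral_iff_ofReal (Filter.Eventually.of_forall fun ω => (Real.exp_pos _).le)]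
    exact (hZ i hi).trans_lt (by simp)
  have hg2 : ∀ i ∈ N, ∫ ω, g i ω ∂μ ≤ 2 := fun i hi => by
    rw [integral_eq_lintegral_of_nonneg_ae
      (Filter.Eventually.of_forall fun ω => (Real.exp_pos _).le) (hgm i hi).aestronglyMeasurable]
    exact ENNReal.toReal_le_of_le_ofReal zero_le_two ((hZ i hi).trans_eq (by simp))
  have hpt : ∀ᵐ ω ∂μ, f ω ≤ c * t ^ 2 * (Real.log K - 1 + (∑ i ∈ N, g i ω) / K) := by
    filter_upwards [hf] with ω hω
    set S := ∑ i ∈ N, g i ω with hS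
    have hgS : ∀ i ∈ N, g i ω ≤ S := fun i hi =>
      Finset.single_le_sum (f := fun i => g i ω) (fun j _ => (Real.exp_pos _).le) hi
    obtain ⟨i₀, hi₀⟩ := hN
    have hS0 : 0 < S := (Real.exp_pos _).trans_le (hgS i₀ hi₀)
    have hlog : ∀ i ∈ N, (Z i ω / t) ^ 2 ≤ Real.log S := fun i hi =>
      (Real.le_log_iff_exp_le hS0).2 (hgS i hi)
    have hlog0 : 0 ≤ Real.log S := (sq_nonneg _).trans (hlog i₀ hi₀)
    have hM := hω (t * √(Real.log S)) fun i hi => by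
      have h := Real.abs_le_sqrt (hlog i hi)
      rwa [abs_div, abs_of_pos ht, div_le_iff₀' ht] at h
    rw [mul_pow, Real.sq_sqrt hlog0, ← mul_assoc] at hM
    refine hM.trans (mul_le_mul_of_nonneg_left ?_ (by positivity))
    -- The tangent line of `log` at `K` takes the place of Jensen's inequality; `𝔼 S ≤ 2K` then
    -- yields `log K + 1`.
    have := Real.log_le_sub_one_of_pos (div_pos hS0 hK0)
    rw [Real.log_div hS0.ne' hK0.ne'] at this
    linarith
  have hsum : Integrable (fun ω => ∑ i ∈ N, g i ω) μ := integrable_finsetSum _ hgi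
  have hbound : Integrable
      (fun ω => c * t ^ 2 * (Real.log K - 1 + (∑ i ∈ N, g i ω) / K)) μ :=
    ((integrable_const _).add (hsum.div_const K)).const_mul _
  have hfi : Integrable f μ := hbound.mono' hfm (by
    filter_upwards [hpt] with ω hω
    rwa [Real.norm_of_nonneg (hf0 ω)])
  refine ⟨hfi, (integral_mono_ae hfi hbound hpt).trans ?_⟩
  rw [integral_const_mul, integral_add (integrable_const _) (hsum.div_const K), integral_div,
    integral_finsetSum _ hgi]
  simp only [integral_const, probReal_univ, one_smul]
  have hle : (∑ i ∈ N, ∫ ω, g i ω ∂μ) / K ≤ 2 := by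
    rw [div_le_iff₀ hK0]
    calc ∑ i ∈ N, ∫ ω, g i ω ∂μ ≤ ∑ _i ∈ N, (2 : ℝ) := Finset.sum_le_sum hg2
      _ = 2 * N.card := by simp [mul_comm]
      _ ≤ 2 * K := by gcongr
  exact mul_le_mul_of_nonneg_left (by linarith) (by positivity)

end Expectation

/-! ### The net for the constraint set, the basic inequality and the entropy bound -/

section Assembly

variable {n p m q r : ℕ}

theorem rank_sub_le (A B : Matrix (Fin n) (Fin m) ℝ) : (A - B).rank ≤ A.rank + B.rank := by
  have h : LinearMap.range (A - B).mulVecLin ≤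
      LinearMap.range A.mulVecLin ⊔ LinearMap.range B.mulVecLin := by
    rintro _ ⟨x, rfl⟩
    rw [Matrix.mulVecLin_apply, Matrix.sub_mulVec]
    exact Submodule.sub_mem _ (Submodule.mem_sup_left ⟨x, rfl⟩) (Submodule.mem_sup_right ⟨x, rfl⟩)
  exact (Submodule.finrank_mono h).trans (Submodule.finrank_add_le_finrank_add_finrank _ _)

/-- A finite set of matrices in the Frobenius unit ball which controls `⟨A, X B - X B'⟩` for all
`B` in the constraint set. -/
theorem exists_constraintSet_net (hqp : q ≤ p) (X : Matrix (Fin n) (Fin p) ℝ)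
    {B' : Matrix (Fin p) (Fin m) ℝ} (hB' : B' ∈ constraintSet p m q r) :
    ∃ N : Finset (Matrix (Fin n) (Fin m) ℝ), N.Nonempty ∧
      N.card ≤ q ^ (4 * (p - q)) * 5 ^ (2 * r * (2 * min q X.rank + m)) ∧
      (∀ D ∈ N, frobNorm D ≤ 1) ∧
      ∀ (A : Matrix (Fin n) (Fin m) ℝ) (M : ℝ), (∀ D ∈ N, |frobInner A D| ≤ M) →
        ∀ B ∈ constraintSet p m q r,
          frobInner A (X * B - X * B') ≤ 4 * M * frobNorm (X * B - X * B') := by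
  classical
  obtain ⟨𝒲, hcard, hdim, hcover⟩ := exists_clustering_subspaces hqp m
  obtain ⟨W', hW', hBW'⟩ := hcover B' hB'.1
  -- `B'` is fixed, so `W'` is too: only the subspace of `B` is counted.
  let V : Submodule ℝ (Fin p → ℝ) → Submodule ℝ (Fin n → ℝ) := fun W =>
    W.map X.mulVecLin ⊔ W'.map X.mulVecLin
  have hmap : ∀ W ∈ 𝒲, Module.finrank ℝ (W.map X.mulVecLin) ≤ min q X.rank := fun W hW =>
    le_min ((Submodule.finrank_map_le _ _).trans (hdim W hW))
      (Submodule.finrank_mono LinearMap.map_le_range)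
  have hV : ∀ W ∈ 𝒲, Module.finrank ℝ (V W) ≤ 2 * min q X.rank := fun W hW => by
    have := Submodule.finrank_add_le_finrank_add_finrank (W.map X.mulVecLin) (W'.map X.mulVecLin)
    have := hmap W hW
    have := hmap W' hW'
    simp only [V]
    omega
  choose N hne hNcard hN1 hNbound using fun W => exists_lowRank_net (V W) (2 * r) m
  refine ⟨𝒲.biUnion N, ?_, ?_, ?_, ?_⟩
  · exact Finset.Nonempty.biUnion ⟨W', hW'⟩ fun W _ => hne W
  · refine (Finset.card_biUnion_le_card_mul 𝒲 N _ fun W hW => (hNcard W).trans ?_).trans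
      (Nat.mul_le_mul_right _ hcard)
    have := hV W hW
    gcongr
    norm_num
  · intro D hD
    obtain ⟨W, -, hD⟩ := Finset.mem_biUnion.1 hD
    exact hN1 W D hD
  · intro A M hM B hB
    obtain ⟨W, hW, hBW⟩ := hcover B hB.1
    refine hNbound W A _ M (fun x => ?_) ?_ fun D hD => hM D (Finset.mem_biUnion.2 ⟨W, hW, hD⟩)
    · rw [Matrix.sub_mulVec, ← Matrix.mulVec_mulVec, ← Matrix.mulVec_mulVec]
      exact Submodule.sub_mem _
        (Submodule.mem_sup_left (Submodule.mem_map_of_mem (f := X.mulVecLin) (hBW x)))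
        (Submodule.mem_sup_right (Submodule.mem_map_of_mem (f := X.mulVecLin) (hBW' x)))
    · rw [← Matrix.mul_sub]
      have := (Matrix.rank_mul_le_right X (B - B')).trans (rank_sub_le B B')
      have := hB.2
      have := hB'.2
      omega

theorem frobInner_neg_left (A B : Matrix (Fin n) (Fin m) ℝ) :
    frobInner (-A) B = -frobInner A B := by
  simp [frobInner]

theorem IsOptimalCRL.frobNorm_sq_le
    {l₀ : Matrix (Fin n) (Fin m) ℝ → Matrix (Fin n) (Fin m) ℝ → ℝ}
    {X : Matrix (Fin n) (Fin p) ℝ} {Y : Matrix (Fin n) (Fin m) ℝ}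
    {B Bstar : Matrix (Fin p) (Fin m) ℝ} {δ : ℝ} (hopt : IsOptimalCRL l₀ X Y q r B)
    (hBstar : Bstar ∈ constraintSet p m q r)
    (hconv : δ * D2 (X * B) (X * Bstar) ≤ bregman (fun Θ => l₀ Θ Y) (X * B) (X * Bstar)) :
    δ * (frobNorm (X * B - X * Bstar) ^ 2 / 2) ≤
      frobInner (effectiveNoise l₀ X Bstar Y) (X * B - X * Bstar) := by
  have hmin : l₀ (X * B) Y ≤ l₀ (X * Bstar) Y := hopt.2 hBstar
  rw [effectiveNoise, frobInner_neg_left]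
  simp only [bregman, D2] at hconv
  linarith

theorem log_net_card_le {K : ℕ} (hqp : q ≤ p) (s : ℕ) (hK : 0 < K)
    (hKle : K ≤ q ^ (4 * (p - q)) * 5 ^ (2 * r * (2 * s + m))) :
    Real.log ((q ^ (4 * (p - q)) * 5 ^ (2 * r * (2 * s + m)) : ℕ) : ℝ) ≤
      8 * (((s : ℝ) + m) * r + ((p : ℝ) - q) * Real.log q) := by
  -- The power vanishes only if `q = 0 < p`, which a nonempty net excludes.
  have hq : (q : ℝ) ^ (4 * (p - q)) ≠ 0 := by
    intro h
    have h' : q ^ (4 * (p - q)) = 0 := by exact_mod_cast h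
    rw [h', zero_mul] at hKle
    omega
  push_cast
  rw [Real.log_mul hq (by positivity), Real.log_pow, Real.log_pow]
  push_cast [Nat.cast_sub hqp]
  have h5 : Real.log 5 ≤ 2 := by
    rw [Real.log_le_iff_le_exp (by norm_num)]
    have h1 := Real.exp_one_gt_d9
    have h2 : Real.exp 2 = Real.exp 1 * Real.exp 1 := by rw [← Real.exp_add]; norm_num
    rw [h2]
    nlinarith
  have hpq : (q : ℝ) ≤ p := by exact_mod_cast hqp
  have hlogq : 0 ≤ ((p : ℝ) - q) * Real.log q :=
    mul_nonneg (by linarith) (Real.log_natCast_nonneg q)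
  have hmul : 2 * (r : ℝ) * (2 * s + m) * Real.log 5 ≤ 2 * (r : ℝ) * (2 * s + m) * 2 :=
    mul_le_mul_of_nonneg_left h5 (by positivity)
  have : 0 ≤ (m : ℝ) * r := by positivity
  nlinarith

theorem IsSubGaussianNoise.lintegral_exp_sq_le_two {Ω : Type*} [MeasurableSpace Ω] {μ : Measure Ω}
    {E : Ω → Matrix (Fin n) (Fin m) ℝ} {σ t : ℝ} (hE : IsSubGaussianNoise μ E σ) (hσ : 0 ≤ σ)
    (ht : σ < t) {D : Matrix (Fin n) (Fin m) ℝ} (hD : frobNorm D ≤ 1) :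
    ∫⁻ ω, ENNReal.ofReal (Real.exp ((frobInner (E ω) D / t) ^ 2)) ∂μ ≤ 2 :=
  CRL.lintegral_exp_sq_le_two (hE.psi2_le D)
    ((mul_le_of_le_one_right hσ hD).trans_lt ht) (hσ.trans_lt ht)

theorem IsSubGaussianNoise.aemeasurable_frobInner {Ω : Type*} [MeasurableSpace Ω] {μ : Measure Ω}
    {E : Ω → Matrix (Fin n) (Fin m) ℝ} {σ : ℝ} (hE : IsSubGaussianNoise μ E σ)
    (D : Matrix (Fin n) (Fin m) ℝ) : AEMeasurable (fun ω => frobInner (E ω) D) μ :=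
  Finset.aemeasurable_fun_sum _ fun i _ => Finset.aemeasurable_fun_sum _ fun j _ =>
    (hE.aemeasurable i j).mul_const _

theorem aemeasurable_frobNorm_sq_mul_sub {Ω : Type*} [MeasurableSpace Ω] {μ : Measure Ω}
    (X : Matrix (Fin n) (Fin p) ℝ) (Θ : Matrix (Fin n) (Fin m) ℝ)
    {B : Ω → Matrix (Fin p) (Fin m) ℝ} (hB : ∀ i j, AEMeasurable (fun ω => B ω i j) μ) :
    AEMeasurable (fun ω => frobNorm (X * B ω - Θ) ^ 2) μ := by
  simp only [frobNorm_sq, Matrix.sub_apply, Matrix.mul_apply]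
  exact Finset.aemeasurable_fun_sum _ fun i _ => Finset.aemeasurable_fun_sum _ fun j _ =>
    ((Finset.aemeasurable_fun_sum _ fun l _ => (hB l j).const_mul _).sub_const _).pow_const 2

end Assembly

end CRL

end

theorem theorem3 :
    ∃ C : ℝ, 0 < C ∧
      ∀ {Ω : Type*} [MeasurableSpace Ω] (μ : Measure Ω) [IsProbabilityMeasure μ]
        (n p m q r : ℕ)
        (l₀ : Matrix (Fin n) (Fin m) ℝ → Matrix (Fin n) (Fin m) ℝ → ℝ)
        (X : Matrix (Fin n) (Fin p) ℝ)
        (Y : Ω → Matrix (Fin n) (Fin m) ℝ)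
        (Bstar : Matrix (Fin p) (Fin m) ℝ)
        (Bhat : Ω → Matrix (Fin p) (Fin m) ℝ)
        (σ δ : ℝ),
        0 ≤ σ → 0 < δ →
        -- the loss is differentiable in the systematic component
        (∀ᵐ ω ∂μ, Differentiable ℝ fun Θ => l₀ Θ (Y ω)) →
        -- the effective noise is sub-Gaussian with mean zero and scale bounded by `σ`
        CRL.IsSubGaussianNoise μ (fun ω => CRL.effectiveNoise l₀ X Bstar (Y ω)) σ →
        -- `r ≥ r*`, `q ≥ q*`, and there are at most as many groups as features
        Bstar.rank ≤ r → CRL.numDistinctRows Bstar ≤ q → q ≤ p →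
        -- `Bhat` is a (measurable) optimal CRL solution
        (∀ i j, AEMeasurable (fun ω => Bhat ω i j) μ) →
        (∀ᵐ ω ∂μ, CRL.IsOptimalCRL l₀ X (Y ω) q r (Bhat ω)) →
        -- restricted strong convexity
        (∀ᵐ ω ∂μ, ∀ B₁ ∈ CRL.constraintSet p m q r, ∀ B₂ ∈ CRL.constraintSet p m q r,
          δ * CRL.D2 (X * B₁) (X * B₂) ≤
            CRL.bregman (fun Θ => l₀ Θ (Y ω)) (X * B₁) (X * B₂)) →
        Integrable (fun ω => CRL.frobNorm (X * Bhat ω - X * Bstar) ^ 2) μ ∧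
        ∫ ω, CRL.frobNorm (X * Bhat ω - X * Bstar) ^ 2 ∂μ ≤
          C * (1 / δ ^ 2 *
            (σ ^ 2 * (((min q X.rank : ℕ) : ℝ) + m) * r
              + σ ^ 2 * ((p : ℝ) - q) * Real.log q + σ ^ 2)) := by
  -- `512 = 64 · 8`: 64 from squaring `8M/δ`, 8 from `log_net_card_le`.
  refine ⟨512, by norm_num, ?_⟩
  intro Ω _ μ _ n p m q r l₀ X Y Bstar Bhat σ δ hσ hδ _ hE hrank hrows hqp hBhat hopt hconv
  have hBstar : Bstar ∈ CRL.constraintSet p m q r := ⟨hrows, hrank⟩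
  obtain ⟨N, hne, hcard, hN1, hNbound⟩ := CRL.exists_constraintSet_net hqp X hBstar
  have hpt : ∀ᵐ ω ∂μ, ∀ M,
      (∀ D ∈ N, |CRL.frobInner (CRL.effectiveNoise l₀ X Bstar (Y ω)) D| ≤ M) →
        CRL.frobNorm (X * Bhat ω - X * Bstar) ^ 2 ≤ 64 / δ ^ 2 * M ^ 2 := by
    filter_upwards [hopt, hconv] with ω hω hcω M hM
    have hlow := hω.frobNorm_sq_le hBstar (hcω _ hω.1 _ hBstar)
    have hup := hNbound _ M hM _ hω.1
    have hM0 : 0 ≤ M := by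
      obtain ⟨D, hD⟩ := hne
      exact (abs_nonneg _).trans (hM D hD)
    set d := CRL.frobNorm (X * Bhat ω - X * Bstar)
    have hd0 : 0 ≤ d := CRL.frobNorm_nonneg _
    have hdM : d ≤ 8 * M / δ := by
      rw [le_div_iff₀ hδ]
      rcases hd0.eq_or_lt with h | h
      · rw [← h, zero_mul]
        positivity
      · refine le_of_mul_le_mul_right ?_ h
        nlinarith
    calc d ^ 2 ≤ (8 * M / δ) ^ 2 := by gcongr
      _ = 64 / δ ^ 2 * M ^ 2 := by ring
  have hmain : ∀ t, σ < t →
      Integrable (fun ω => CRL.frobNorm (X * Bhat ω - X * Bstar) ^ 2) μ ∧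
      ∫ ω, CRL.frobNorm (X * Bhat ω - X * Bstar) ^ 2 ∂μ ≤ 64 / δ ^ 2 * t ^ 2 *
        (Real.log ((q ^ (4 * (p - q)) * 5 ^ (2 * r * (2 * min q X.rank + m)) : ℕ) : ℝ) + 1) :=
    fun t ht => CRL.integral_le_of_le_sq_max hne (hσ.trans_lt ht) (by positivity)
      (Nat.cast_le.2 hcard) (fun D _ => hE.aemeasurable_frobInner D)
      (fun D hD => hE.lintegral_exp_sq_le_two hσ ht (hN1 D hD))
      (CRL.aemeasurable_frobNorm_sq_mul_sub X _ hBhat).aestronglyMeasurable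
      (fun ω => sq_nonneg _) hpt
  refine ⟨(hmain (σ + 1) (by linarith)).1, ?_⟩
  -- The exponential moment bound is available only at scales `t > σ` (the infimum need not be
  -- attained, and `σ` may be 0), so let `t` decrease to `σ`.
  have hlim : ∫ ω, CRL.frobNorm (X * Bhat ω - X * Bstar) ^ 2 ∂μ ≤ 64 / δ ^ 2 * σ ^ 2 *
      (Real.log ((q ^ (4 * (p - q)) * 5 ^ (2 * r * (2 * min q X.rank + m)) : ℕ) : ℝ) + 1) := by
    have hcont : Continuous fun t : ℝ => 64 / δ ^ 2 * t ^ 2 *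
        (Real.log ((q ^ (4 * (p - q)) * 5 ^ (2 * r * (2 * min q X.rank + m)) : ℕ) : ℝ) + 1) := by
      fun_prop
    exact ge_of_tendsto ((hcont.tendsto σ).mono_left (nhdsWithin_le_nhds (s := Set.Ioi σ)))
      (Filter.eventually_of_mem self_mem_nhdsWithin fun t ht => (hmain t ht).2)
  have hlog := CRL.log_net_card_le hqp (min q X.rank) hne.card_pos hcard
  calc _ ≤ _ := hlim
    _ ≤ 64 / δ ^ 2 * σ ^ 2 * (8 * ((((min q X.rank : ℕ) : ℝ) + m) * r +
          ((p : ℝ) - q) * Real.log q) + 8) := by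
        gcongr
        norm_num
    _ = _ := by ring
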